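/- Let $\mathbb F_q$ be a finite field of odd characteristic with $q$ elements, and let $\mathrm{dot}_n(x)=x_1^2+\cdots+x_n^2$ on $\mathbb F_q^n$. A subspace $W\subseteq\mathbb F_q^n$ is a $\mathrm{dot}_k$-subspace if $(W,\mathrm{dot}_n|_W)$ is isometrically isomorphic to $(\mathbb F_q^k,\mathrm{dot}_k)$. Let $\binom{n}{k}_d$ be the number of $\mathrm{dot}_k$-subspaces of $(\mathbb F_q^n,\mathrm{dot}_n)$, let $[n]_d=\binom n1_d$ for $n\ge 1$ (and $[0]_d=1$), and let $[n]_d!=[n]_d[n-1]_d\cdots[1]_d$ (so $[0]_d!=1$). The Euclidean poset $E_n(q)$ is the set of all $\mathrm{dot}_k$-subspaces of $(\mathbb F_q^n,\mathrm{dot}_n)$, $0\le k\le n$, ordered by inclusion; a Euclidean flag is a maximal chain in $E_n(q)$. Let $O(n,q)=\{A\in \mathbb F_q^{n\times n}: AA^{T}=I\}$ be the orthogonal group of $(\mathbb F_q^n,\mathrm{dot}_n)$. Then: 1. For every $n\ge 0$, the number of Euclidean flags in $E_n(q)$ is $[n]_d!$, and it equals $|O(n,q)|/2^n$; hence $|O(n,q)|=2^n\,[n]_d!$.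 2. For every $n\ge 0$, $$|O(2n+1,q)|=2q^{n}\prod_{k=0}^{n-1}\left(q^{2n}-q^{2k}\right).$$ 3. For every $n\ge 1$, $$|O(2n,q)|=\begin{cases}2\left(q^{n}-1\right)\prod_{k=1}^{n-1}\left(q^{2n}-q^{2k}\right)&\text{if } q\equiv 1 \pmod 4,\\[2pt] 2\left(q^{n}+(-1)^{n+1}\right)\prod_{k=1}^{n-1}\left(q^{2n}-q^{2k}\right)&\text{if } q\equiv 3 \pmod 4.\end{cases}$$ 4. For all $0\le k\le n$, $$\binom{n}{k}_d=\frac{[n]_d!}{[k]_d!\,[n-k]_d!}=\left|\frac{O(n,q)}{O(k,q)\times O(n-k,q)}\right|,$$ where $O(k,q)\times O(n-k,q)$ is embedded in $O(n,q)$ as the block diagonal matrices $\mathrm{diag}(A,B)$, and the quotient is the set of cosets. -/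

import Mathlib

namespace DotAnalogue

/-- The quadratic form `dot_n(x) = x₁² + ⋯ + xₙ²` on `Fⁿ`. -/
noncomputable def dotForm (F : Type*) [Field F] (n : ℕ) : QuadraticForm F (Fin n → F) :=
  QuadraticMap.weightedSumSquares F (fun _ : Fin n => (1 : F))

/-- `W` is a `dot_k`-subspace of `(Fⁿ, dot_n)`: the restriction of `dot_n` to `W` is
isometrically isomorphic to `(Fᵏ, dot_k)`. -/
def IsDotSubspace {F : Type*} [Field F] {n : ℕ} (k : ℕ) (W : Submodule F (Fin n → F)) : Prop :=
  Nonempty (((dotForm F n).restrict W).IsometryEquiv (dotForm F k))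

/-- The set `dot_{k,n}` of all `dot_k`-subspaces of `(Fⁿ, dot_n)`. -/
def dotSubspaces (F : Type*) [Field F] (k n : ℕ) : Set (Submodule F (Fin n → F)) :=
  {W | IsDotSubspace k W}

/-- The Euclidean poset: all `dot_k`-subspaces of `(Fⁿ, dot_n)`, for all `k` (necessarily
`k ≤ n`), ordered by inclusion. -/
abbrev EuclideanPoset (F : Type*) [Field F] (n : ℕ) : Type _ :=
  {W : Submodule F (Fin n → F) // ∃ k : ℕ, IsDotSubspace k W}

/-- A Euclidean flag: a maximal chain of the Euclidean poset. -/
abbrev EuclideanFlag (F : Type*) [Field F] (n : ℕ) : Type _ :=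
  Flag (EuclideanPoset F n)

/-- The bracket `[n]_d`: the number of `dot_1`-subspaces (spacelike lines) of `(Fⁿ, dot_n)`,
with the convention `[0]_d = 1`. -/
noncomputable def dotBracket (F : Type*) [Field F] (n : ℕ) : ℕ :=
  if n = 0 then 1 else (dotSubspaces F 1 n).ncard

/-- The factorial `[n]_d! = [n]_d [n-1]_d ⋯ [1]_d`. -/
noncomputable def dotFactorial (F : Type*) [Field F] (n : ℕ) : ℕ :=
  ∏ k ∈ Finset.Icc 1 n, dotBracket F k

/-- The dot-binomial coefficient: the number of `dot_k`-subspaces of `(Fⁿ, dot_n)`. -/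
noncomputable def dotBinomial (F : Type*) [Field F] (n k : ℕ) : ℕ :=
  (dotSubspaces F k n).ncard

/-- The orthogonal group of `(Fⁿ, dot_n)`: the `n × n` matrices `A` with `A * Aᵀ = 1`. -/
abbrev O (n : ℕ) (F : Type*) [Field F] : Type _ :=
  Matrix.orthogonalGroup (Fin n) F

/-- The identification of `{1, …, k} ⊔ {1, …, n - k}` with `{1, …, n}`, the first block being
sent to the first `k` indices and the second one to the last `n - k`. -/
def blockEquiv {k n : ℕ} (h : k ≤ n) : Fin k ⊕ Fin (n - k) ≃ Fin n :=
  finSumFinEquiv.trans (finCongr (Nat.add_sub_of_le h))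

theorem block_mem {F : Type*} [Field F] {k n : ℕ} (h : k ≤ n) (A : O k F) (B : O (n - k) F) :
    Matrix.reindex (blockEquiv h) (blockEquiv h)
      (Matrix.fromBlocks (A : Matrix (Fin k) (Fin k) F) 0 0
        (B : Matrix (Fin (n - k)) (Fin (n - k)) F)) ∈ Matrix.orthogonalGroup (Fin n) F := by
  have hA := (Matrix.mem_orthogonalGroup_iff (Fin k) F).1 A.2
  have hB := (Matrix.mem_orthogonalGroup_iff (Fin (n - k)) F).1 B.2
  rw [Matrix.mem_orthogonalGroup_iff]
  simp [Matrix.submatrix_mul_equiv, Matrix.fromBlocks_transpose, Matrix.fromBlocks_multiply,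
    hA, hB]

/-- The embedding `O(k) × O(n - k) → O(n)`, `(A, B) ↦ diag(A, B)`. -/
def blockHom (F : Type*) [Field F] {k n : ℕ} (h : k ≤ n) :
    O k F × O (n - k) F →* O n F where
  toFun p := ⟨_, block_mem h p.1 p.2⟩
  map_one' := by
    apply Subtype.ext
    simp
  map_mul' p p' := by
    apply Subtype.ext
    simp [Matrix.submatrix_mul_equiv, Matrix.fromBlocks_multiply]

theorem blockHom_injective (F : Type*) [Field F] {k n : ℕ} (h : k ≤ n) :
    Function.Injective (blockHom F h) := by
  rintro ⟨A, B⟩ ⟨A', B'⟩ hAB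
  have h1 := congrArg Subtype.val hAB
  have h2 := Matrix.fromBlocks_inj.1 ((Matrix.reindex (blockEquiv h) (blockEquiv h)).injective h1)
  exact Prod.ext (Subtype.ext h2.1) (Subtype.ext h2.2.2.2)

/-- `O(k) × O(n - k)` as the subgroup of block diagonal matrices in `O(n)`. -/
def blockSubgroup (F : Type*) [Field F] {k n : ℕ} (h : k ≤ n) : Subgroup (O n F) :=
  (blockHom F h).range

end DotAnalogue

/-! Everything is orbit counting for O(n). In odd characteristic a product of at most two
reflections carries any unit vector to any other and fixes whatever is orthogonal to both
(`exists_move`). Moving one basis vector at a time gives Witt's theorem for isometric copies of (Fᵏ,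
dot_k) (`exists_move_isometry`). Three transitive actions result.

On unit vectors the stabilizer is O(n-1), so |O(n)| is a product of sphere sizes; a Jacobi sum gives
these a two-step recursion (`sphereCard_add_two`), whence the explicit orders.

On dot_k-subspaces the stabilizer is O(k) × O(n-k) (`mem_blockSubgroup`). The case k = 1, with
|O(1)| = 2, reads |O(n)| = 2 [n]_d |O(n-1)|, whence |O(n)| = 2ⁿ [n]_d! and the binomial formula.

On Euclidean flags the stabilizer is the group of 2ⁿ sign matrices. Transitivity holds because a
maximal chain skips no dimension, so it consists of the column spans of one orthogonal matrix
(`colFlag_surjective`). -/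

namespace DotAnalogue

open Matrix

/-! ### Counting vectors of given length -/

section Sphere

variable (F : Type*) [Field F] [Fintype F]

/-- The number of vectors `x` of `Fⁿ` with `dot_n(x) = c`. -/
noncomputable def sphereCard (n : ℕ) (c : F) : ℕ :=
  Nat.card {x : Fin n → F // x ⬝ᵥ x = c}

variable [DecidableEq F]

theorem sphereCard_eq_sum (n : ℕ) (c : F) :
    (sphereCard F n c : ℤ) = ∑ x : Fin n → F, if x ⬝ᵥ x = c then 1 else 0 := by
  rw [sphereCard, Nat.card_eq_fintype_card, Fintype.card_subtype]
  simp

theorem sphereCard_succ (n : ℕ) (c : F) :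
    (sphereCard F (n + 1) c : ℤ) = ∑ a : F, (sphereCard F n (c - a ^ 2) : ℤ) := by
  simp only [sphereCard_eq_sum]
  rw [← (Fin.consEquiv fun _ => F).sum_comp, Fintype.sum_prod_type]
  refine Finset.sum_congr rfl fun a _ => Finset.sum_congr rfl fun x _ => ?_
  refine if_congr ?_ rfl rfl
  simp only [Fin.consEquiv_apply, dotProduct, Fin.sum_univ_succ, Fin.cons_zero, Fin.cons_succ]
  rw [eq_sub_iff_add_eq', sq]

/-- The value of the quadratic Jacobi sum `∑ χ(a) χ(d - a)`. -/
theorem sum_quadraticChar_mul_sub (hF : ringChar F ≠ 2) (d : F) :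
    ∑ a : F, quadraticChar F a * quadraticChar F (d - a) =
      (if d = 0 then (Fintype.card F : ℤ) * quadraticChar F (-1) else 0)
        - quadraticChar F (-1) := by
  split_ifs with hd
  · subst hd
    have h : ∀ a : F, quadraticChar F a * quadraticChar F (0 - a) =
        quadraticChar F (-1) - if a = 0 then quadraticChar F (-1) else 0 := by
      intro a
      split_ifs with ha
      · simp [ha]
      · rw [zero_sub, ← neg_one_mul a, map_mul, mul_left_comm, ← sq, quadraticChar_sq_one ha]
        simp
    rw [Finset.sum_congr rfl fun a _ => h a, Finset.sum_sub_distrib]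
    simp
  -- The quadratic character χ is its own inverse, so J(χ, χ) = -χ(-1). Substituting d * a for a
  -- reduces to this, since χ(d)² = 1.
  · have h := jacobiSum_nontrivial_inv (R := ℤ) (quadraticChar_ne_one hF)
    rw [(quadraticChar_isQuadratic F).inv, jacobiSum] at h
    rw [zero_sub, ← h, ← _root_.Equiv.sum_comp (Equiv.mulLeft₀ d hd)]
    refine Finset.sum_congr rfl fun a _ => ?_
    have e : d - d * a = d * (1 - a) := by ring
    rw [show Equiv.mulLeft₀ d hd a = d * a from rfl, e, map_mul, map_mul, mul_mul_mul_comm, ← sq, quadraticChar_sq_one hd,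
      one_mul]

/-- Each c has χ(c) + 1 square roots. -/
theorem sum_comp_sq (hF : ringChar F ≠ 2) (f : F → ℤ) :
    ∑ a : F, f (a ^ 2) = ∑ c : F, (quadraticChar F c + 1) * f c := by
  rw [← Finset.sum_fiberwise' (s := Finset.univ) (g := fun a : F => a ^ 2) f]
  refine Finset.sum_congr rfl fun c _ => ?_
  rw [Finset.sum_const, ← quadraticChar_card_sqrts hF, nsmul_eq_mul]
  congr 3
  ext; simp

/-- Split off two coordinates. The number of (a, b) with a² + b² = d is q - χ(-1), plus q χ(-1) when
d = 0 (`hN`). The constant part meets every vector of Fⁿ once (`htot`); the correction sees only the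
sphere of the same c. -/
theorem sphereCard_add_two (hF : ringChar F ≠ 2) (n : ℕ) (c : F) :
    (sphereCard F (n + 2) c : ℤ) =
      ((Fintype.card F : ℤ) - quadraticChar F (-1)) * (Fintype.card F : ℤ) ^ n
        + (Fintype.card F : ℤ) * quadraticChar F (-1) * sphereCard F n c := by
  have htot : ∑ d : F, (sphereCard F n (c - d) : ℤ) = (Fintype.card F : ℤ) ^ n := by
    simp only [sphereCard_eq_sum]
    rw [Finset.sum_comm]
    have : ∀ x : Fin n → F, ∑ d : F, (if x ⬝ᵥ x = c - d then (1 : ℤ) else 0) = 1 := by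
      intro x
      have h : ∀ d : F, x ⬝ᵥ x = c - d ↔ d = c - x ⬝ᵥ x := fun d =>
        ⟨fun h => by rw [h]; ring, fun h => by rw [h]; ring⟩
      simp [h]
    simp [this]
  have hN : ∀ d : F, ∑ a : F, (quadraticChar F a + 1) * (quadraticChar F (d - a) + 1) =
      ((Fintype.card F : ℤ) - quadraticChar F (-1)) +
        if d = 0 then (Fintype.card F : ℤ) * quadraticChar F (-1) else 0 := by
    intro d
    have h0 := quadraticChar_sum_zero hF
    have h1 : ∑ a : F, quadraticChar F (d - a) = 0 := by
      rw [← h0, ← (Equiv.subLeft d).sum_comp (quadraticChar F)]; rfl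
    simp only [add_mul, mul_add, one_mul, mul_one, Finset.sum_add_distrib, h0, h1,
      sum_quadraticChar_mul_sub F hF]
    simp
    ring
  rw [sphereCard_succ]
  simp only [sphereCard_succ F n]
  rw [sum_comp_sq F hF fun a => ∑ b : F, (sphereCard F n (c - a - b ^ 2) : ℤ)]
  simp only [fun a : F => sum_comp_sq F hF fun b => (sphereCard F n (c - a - b) : ℤ)]
  have hre : ∀ a : F, ∑ b : F, (quadraticChar F b + 1) * (sphereCard F n (c - a - b) : ℤ) =
      ∑ d : F, (quadraticChar F (d - a) + 1) * (sphereCard F n (c - d) : ℤ) := by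
    intro a
    rw [← (Equiv.subRight a).sum_comp]
    refine Finset.sum_congr rfl fun d _ => ?_
    simp
  simp only [hre, Finset.mul_sum]
  rw [Finset.sum_comm]
  have hre2 : ∀ d : F, ∑ a : F, (quadraticChar F a + 1) *
      ((quadraticChar F (d - a) + 1) * (sphereCard F n (c - d) : ℤ)) =
      ((Fintype.card F : ℤ) - quadraticChar F (-1)) * (sphereCard F n (c - d) : ℤ) +
      if d = 0 then (Fintype.card F : ℤ) * quadraticChar F (-1) * sphereCard F n c else 0 := by
    intro d
    simp only [← mul_assoc]
    rw [← Finset.sum_mul, hN]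
    split_ifs with h
    · rw [h]; simp; ring
    · ring
  simp only [hre2, Finset.sum_add_distrib, ← Finset.mul_sum, htot]
  simp

theorem sphereCard_even (hF : ringChar F ≠ 2) (n : ℕ) :
    (sphereCard F (2 * n + 2) (1 : F) : ℤ) = (Fintype.card F : ℤ) ^ n *
      ((Fintype.card F : ℤ) ^ (n + 1) - quadraticChar F (-1) ^ (n + 1)) := by
  induction n with
  | zero =>
    have h0 : (sphereCard F 0 (1 : F) : ℤ) = 0 := by simp [sphereCard_eq_sum]
    rw [mul_zero, sphereCard_add_two F hF, h0]
    simp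
  | succ n ih =>
    rw [show 2 * (n + 1) = 2 * n + 2 by ring, sphereCard_add_two F hF, ih]
    ring

theorem sphereCard_odd (hF : ringChar F ≠ 2) (n : ℕ) :
    (sphereCard F (2 * n + 1) (1 : F) : ℤ) = (Fintype.card F : ℤ) ^ n *
      ((Fintype.card F : ℤ) ^ n + quadraticChar F (-1) ^ n) := by
  induction n with
  | zero =>
    have h : ∀ a : F, (sphereCard F 0 (1 - a) : ℤ) = if a = 1 then 1 else 0 := by
      intro a
      have : (0 : F) = 1 - a ↔ a = 1 := by rw [eq_comm, sub_eq_zero, eq_comm]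
      simp [sphereCard_eq_sum, this]
    rw [mul_zero, sphereCard_succ,
      sum_comp_sq F hF fun a => (sphereCard F 0 (1 - a) : ℤ)]
    simp [h]
  | succ n ih =>
    rw [show 2 * (n + 1) + 1 = 2 * n + 1 + 2 by ring, sphereCard_add_two F hF, ih]
    ring

end Sphere

/-! ### Reflections and Witt's theorem -/

variable {F : Type*} [Field F]

theorem dotForm_apply {n : ℕ} (x : Fin n → F) : dotForm F n x = x ⬝ᵥ x := by
  simp [dotForm, QuadraticMap.weightedSumSquares_apply, dotProduct]

/-- The reflection in the hyperplane orthogonal to `u`. -/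
def reflection {n : ℕ} (u : Fin n → F) : Matrix (Fin n) (Fin n) F :=
  1 - (2 / (u ⬝ᵥ u)) • vecMulVec u u

theorem reflection_mulVec {n : ℕ} (u x : Fin n → F) :
    reflection u *ᵥ x = x - (2 * (u ⬝ᵥ x) / (u ⬝ᵥ u)) • u := by
  ext i
  simp [reflection, sub_mulVec, smul_mulVec, vecMulVec_mulVec]
  ring

theorem reflection_mem {n : ℕ} {u : Fin n → F} (hu : u ⬝ᵥ u ≠ 0) :
    reflection u ∈ orthogonalGroup (Fin n) F := by
  rw [mem_orthogonalGroup_iff]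
  have ht : (reflection u)ᵀ = reflection u := by
    simp [reflection, transpose_vecMulVec]
  rw [ht]
  have h : vecMulVec u u * vecMulVec u u = (u ⬝ᵥ u) • vecMulVec u u := by
    rw [vecMulVec_mul_vecMulVec]
    ext i j
    simp [vecMulVec_apply]
    ring
  simp only [reflection, sub_mul, mul_sub, one_mul, mul_one, smul_mul_assoc, mul_smul_comm, h,
    smul_smul]
  have : 2 / (u ⬝ᵥ u) * (u ⬝ᵥ u) = 2 := div_mul_cancel₀ 2 hu
  rw [this, two_smul, sub_add_cancel_left, smul_neg, sub_neg_eq_add, sub_add_cancel]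

theorem reflection_mulVec_of_orthogonal {n : ℕ} {u x : Fin n → F} (h : u ⬝ᵥ x = 0) :
    reflection u *ᵥ x = x := by
  simp [reflection_mulVec, h]

theorem O.mulVec_dotProduct {n : ℕ} (A : O n F) (x y : Fin n → F) :
    (A.1 *ᵥ x) ⬝ᵥ (A.1 *ᵥ y) = x ⬝ᵥ y := by
  rw [dotProduct_mulVec, ← mulVec_transpose, mulVec_mulVec,
    (mem_orthogonalGroup_iff' (Fin n) F).1 A.2, one_mulVec]

theorem O.mul_mulVec {n : ℕ} (A B : O n F) (x : Fin n → F) :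
    (A * B).1 *ᵥ x = A.1 *ᵥ (B.1 *ᵥ x) := by
  simp

theorem O.inv_mulVec_mulVec {n : ℕ} (A : O n F) (x : Fin n → F) :
    (A⁻¹).1 *ᵥ (A.1 *ᵥ x) = x := by
  rw [← O.mul_mulVec]; simp

theorem O.mulVec_inv_mulVec {n : ℕ} (A : O n F) (x : Fin n → F) :
    A.1 *ᵥ ((A⁻¹).1 *ᵥ x) = x := by
  rw [← O.mul_mulVec]; simp

/-- A unit vector can be moved to any other one while fixing everything orthogonal to both. -/
theorem exists_move (h2 : (2 : F) ≠ 0) {n : ℕ} {a b : Fin n → F} (ha : a ⬝ᵥ a = 1)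
    (hb : b ⬝ᵥ b = 1) :
    ∃ A : O n F, A.1 *ᵥ a = b ∧ ∀ x, a ⬝ᵥ x = 0 → b ⬝ᵥ x = 0 → A.1 *ᵥ x = x := by
  have hab : b ⬝ᵥ a = a ⬝ᵥ b := dotProduct_comm _ _
  have hm : (a - b) ⬝ᵥ (a - b) = 2 * (1 - a ⬝ᵥ b) := by
    simp [sub_dotProduct, dotProduct_sub, ha, hb, hab]; ring
  have hp : (a + b) ⬝ᵥ (a + b) = 2 * (1 + a ⬝ᵥ b) := by
    simp [add_dotProduct, dotProduct_add, ha, hb, hab]; ring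
  -- If a - b is isotropic then a ⬝ᵥ b = 1, so a + b has square length 4 ≠ 0. Its reflection sends a
  -- to -b, and the reflection in b corrects the sign.
  by_cases h : (a - b) ⬝ᵥ (a - b) = 0
  · have h1 : a ⬝ᵥ b = 1 := by
      rw [hm] at h
      have := (mul_eq_zero.1 h).resolve_left h2
      linear_combination -this
    have h0 : (a + b) ⬝ᵥ (a + b) ≠ 0 := by
      rw [hp, h1, one_add_one_eq_two]; exact mul_ne_zero h2 h2
    have hb0 : b ⬝ᵥ b ≠ 0 := by simp [hb]
    refine ⟨⟨_, reflection_mem hb0⟩ * ⟨_, reflection_mem h0⟩, ?_, fun x hax hbx => ?_⟩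
    · rw [O.mul_mulVec]
      have e1 : reflection (a + b) *ᵥ a = -b := by
        rw [reflection_mulVec, hp, add_dotProduct, ha, hab, h1]
        have : (2 * (1 + 1) / (2 * (1 + 1)) : F) = 1 := by
          rw [one_add_one_eq_two]; exact div_self (mul_ne_zero h2 h2)
        rw [this]; simp
      change reflection b *ᵥ (reflection (a + b) *ᵥ a) = b
      rw [e1, mulVec_neg, reflection_mulVec, hb]
      ext i; simp; ring
    · rw [O.mul_mulVec]
      change reflection b *ᵥ (reflection (a + b) *ᵥ x) = x
      rw [reflection_mulVec_of_orthogonal (u := a + b) (by simp [add_dotProduct, hax, hbx]),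
        reflection_mulVec_of_orthogonal hbx]
  · refine ⟨⟨_, reflection_mem h⟩, ?_, fun x hax hbx => ?_⟩
    · change reflection (a - b) *ᵥ a = b
      have : 2 * ((a - b) ⬝ᵥ a) / ((a - b) ⬝ᵥ (a - b)) = 1 := by
        rw [div_eq_one_iff_eq h, hm, sub_dotProduct, ha, hab]
      rw [reflection_mulVec, this]; simp
    · exact reflection_mulVec_of_orthogonal (by simp [sub_dotProduct, hax, hbx])

/-- Witt's theorem for orthonormal families. -/
theorem exists_move_family (h2 : (2 : F) ≠ 0) {n : ℕ} {ι : Type*} [DecidableEq ι]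
    {v w : ι → Fin n → F} (hv : ∀ i j, v i ⬝ᵥ v j = if i = j then 1 else 0)
    (hw : ∀ i j, w i ⬝ᵥ w j = if i = j then 1 else 0) (s : Finset ι) :
    ∃ A : O n F, ∀ i ∈ s, A.1 *ᵥ v i = w i := by
  induction s using Finset.induction_on with
  | empty => exact ⟨1, by simp⟩
  | insert a s has ih =>
    obtain ⟨A, hA⟩ := ih
    -- The earlier w i are orthogonal both to A (v a) and to w a, so B leaves them in place.
    obtain ⟨B, hB, hB'⟩ := exists_move h2 (a := A.1 *ᵥ v a) (b := w a)
      (by rw [O.mulVec_dotProduct, hv, if_pos rfl]) (by rw [hw, if_pos rfl])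
    refine ⟨B * A, fun i hi => ?_⟩
    rw [O.mul_mulVec]
    rcases Finset.mem_insert.1 hi with rfl | hi
    · exact hB
    · have hia : a ≠ i := fun e => has (e ▸ hi)
      rw [hA i hi]
      refine hB' _ ?_ ?_
      · rw [← hA i hi, O.mulVec_dotProduct, hv, if_neg hia]
      · rw [hw, if_neg hia]

/-- Witt's theorem for isometric embeddings of `(Fᵏ, dot_k)`. -/
theorem exists_move_isometry (h2 : (2 : F) ≠ 0) {k n : ℕ} {g h : (Fin k → F) →ₗ[F] (Fin n → F)}
    (hg : ∀ x y, g x ⬝ᵥ g y = x ⬝ᵥ y) (hh : ∀ x y, h x ⬝ᵥ h y = x ⬝ᵥ y) :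
    ∃ A : O n F, ∀ x, A.1 *ᵥ g x = h x := by
  obtain ⟨A, hA⟩ := exists_move_family h2 (v := fun i => g (Pi.single i 1))
    (w := fun i => h (Pi.single i 1)) (fun i j => by simp [hg, Pi.single_apply, eq_comm])
    (fun i j => by simp [hh, Pi.single_apply, eq_comm]) Finset.univ
  refine ⟨A, fun x => ?_⟩
  have : (toLin' A.1) ∘ₗ g = h := by
    refine LinearMap.pi_ext' fun i => LinearMap.ext_ring ?_
    simpa using hA i (Finset.mem_univ i)
  simpa using LinearMap.congr_fun this x

/-! ### Standard subspaces and column spans -/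

/-- Padding a vector of `Fᵏ` by zeros to a vector of `Fⁿ`. -/
def pad (F : Type*) [Field F] (k n : ℕ) : (Fin k → F) →ₗ[F] (Fin n → F) where
  toFun x i := if h : i.1 < k then x ⟨i, h⟩ else 0
  map_add' x y := by
    ext i; by_cases h : i.1 < k <;> simp [h]
  map_smul' c x := by
    ext i; by_cases h : i.1 < k <;> simp [h]

theorem pad_apply {k n : ℕ} (x : Fin k → F) (i : Fin n) :
    pad F k n x i = if h : i.1 < k then x ⟨i, h⟩ else 0 := rfl

theorem pad_self {n : ℕ} (x : Fin n → F) : pad F n n x = x := by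
  ext i; simp [pad_apply]

theorem pad_pad {j k n : ℕ} (hjk : j ≤ k) (x : Fin j → F) :
    pad F k n (pad F j k x) = pad F j n x := by
  ext i
  simp only [pad_apply]
  split_ifs <;> first | rfl | omega

theorem blockEquiv_inl {k n : ℕ} (h : k ≤ n) (i : Fin k) : (blockEquiv h (Sum.inl i)).1 = i := by
  simp [blockEquiv]

theorem blockEquiv_inr {k n : ℕ} (h : k ≤ n) (i : Fin (n - k)) :
    (blockEquiv h (Sum.inr i)).1 = k + i := by
  simp [blockEquiv]

theorem pad_blockEquiv_inl {k n : ℕ} (h : k ≤ n) (x : Fin k → F) (i : Fin k) :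
    pad F k n x (blockEquiv h (Sum.inl i)) = x i := by
  simp [pad_apply, blockEquiv_inl]

theorem pad_blockEquiv_inr {k n : ℕ} (h : k ≤ n) (x : Fin k → F) (i : Fin (n - k)) :
    pad F k n x (blockEquiv h (Sum.inr i)) = 0 := by
  simp [pad_apply, blockEquiv_inr]

theorem pad_dotProduct {k n : ℕ} (h : k ≤ n) (x y : Fin k → F) :
    pad F k n x ⬝ᵥ pad F k n y = x ⬝ᵥ y := by
  simp only [dotProduct]
  rw [← (blockEquiv h).sum_comp, Fintype.sum_sum_type]
  simp [pad_blockEquiv_inl, pad_blockEquiv_inr]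

theorem injective_of_isometry {k n : ℕ} {g : (Fin k → F) →ₗ[F] (Fin n → F)}
    (hg : ∀ x y, g x ⬝ᵥ g y = x ⬝ᵥ y) : Function.Injective g := by
  refine (injective_iff_map_eq_zero g).2 fun x hx => ?_
  refine dotProduct_eq_zero x fun y => ?_
  rw [← hg, hx, zero_dotProduct]

theorem mem_range_pad {k n : ℕ} (x : Fin n → F) :
    x ∈ LinearMap.range (pad F k n) ↔ ∀ i : Fin n, k ≤ i.1 → x i = 0 := by
  constructor
  · rintro ⟨y, rfl⟩ i hi
    simp [pad_apply, hi]
  · intro h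
    -- For k ≤ n, `pad` in this direction truncates to the first k coordinates.
    refine ⟨pad F n k x, ?_⟩
    ext i
    simp only [pad_apply]
    split_ifs with h1
    · rfl
    · exact (absurd i.2 ‹_›)
    · exact (h i (by omega)).symm

/-- The span of the first `k` columns of `A`. -/
def colSpan {n : ℕ} (A : O n F) (k : ℕ) : Submodule F (Fin n → F) :=
  LinearMap.range (toLin' A.1 ∘ₗ pad F k n)

theorem mem_colSpan {n k : ℕ} (A : O n F) (x : Fin n → F) :
    x ∈ colSpan A k ↔ ∃ y, A.1 *ᵥ pad F k n y = x := by
  simp [colSpan]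

theorem mem_colSpan_iff {n k : ℕ} (A : O n F) (x : Fin n → F) :
    x ∈ colSpan A k ↔ (A⁻¹).1 *ᵥ x ∈ LinearMap.range (pad F k n) := by
  rw [mem_colSpan, LinearMap.mem_range]
  refine exists_congr fun y => ⟨fun h => ?_, fun h => ?_⟩
  · rw [← h, O.inv_mulVec_mulVec]
  · rw [h, O.mulVec_inv_mulVec]

theorem colSpan_one {n : ℕ} (k : ℕ) : colSpan (1 : O n F) k = LinearMap.range (pad F k n) := by
  ext x; rw [mem_colSpan_iff]; simp

theorem mulVec_mem_colSpan {n k : ℕ} (A B : O n F) (x : Fin n → F) :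
    A.1 *ᵥ x ∈ colSpan (A * B) k ↔ x ∈ colSpan B k := by
  rw [mem_colSpan_iff, mem_colSpan_iff, _root_.mul_inv_rev, O.mul_mulVec, O.inv_mulVec_mulVec]

theorem colSpan_eq_iff {n k : ℕ} (A B : O n F) :
    colSpan A k = colSpan B k ↔ colSpan (A⁻¹ * B) k = colSpan 1 k := by
  constructor <;> intro h
  · ext x
    rw [← mulVec_mem_colSpan A, mul_inv_cancel_left, ← h, ← mulVec_mem_colSpan A 1, mul_one]
  · ext x
    rw [← mulVec_mem_colSpan A⁻¹, ← mulVec_mem_colSpan A⁻¹ B, h, inv_mul_cancel]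

theorem finrank_colSpan {n k : ℕ} (h : k ≤ n) (A : O n F) :
    Module.finrank F (colSpan A k) = k := by
  rw [colSpan, LinearMap.finrank_range_of_inj, Module.finrank_fin_fun]
  exact injective_of_isometry fun x y => by simp [O.mulVec_dotProduct, pad_dotProduct h]

theorem colSpan_mono {n j k : ℕ} (h : j ≤ k) (A : O n F) : colSpan A j ≤ colSpan A k := by
  intro x hx
  obtain ⟨y, rfl⟩ := (mem_colSpan _ _).1 hx
  exact (mem_colSpan _ _).2 ⟨pad F j k y, by rw [pad_pad h]⟩

theorem finrank_of_isDotSubspace {n k : ℕ} {W : Submodule F (Fin n → F)}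
    (h : IsDotSubspace k W) : Module.finrank F W = k := by
  obtain ⟨e⟩ := h
  rw [e.toLinearEquiv.finrank_eq, Module.finrank_fin_fun]

theorem le_of_isDotSubspace {n k : ℕ} {W : Submodule F (Fin n → F)}
    (h : IsDotSubspace k W) : k ≤ n := by
  rw [← finrank_of_isDotSubspace h]
  exact (Submodule.finrank_le W).trans_eq (Module.finrank_fin_fun F)

/-- Polarization. -/
theorem dotProduct_of_self (h2 : (2 : F) ≠ 0) {k n : ℕ} {g : (Fin k → F) →ₗ[F] (Fin n → F)}
    (hg : ∀ x, g x ⬝ᵥ g x = x ⬝ᵥ x) (x y : Fin k → F) : g x ⬝ᵥ g y = x ⬝ᵥ y := by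
  have h := hg (x + y)
  simp only [map_add, add_dotProduct, dotProduct_add, hg, dotProduct_comm y x,
    dotProduct_comm (g y) (g x)] at h
  refine mul_left_cancel₀ h2 ?_
  linear_combination h

theorem isDotSubspace_colSpan {n k : ℕ} (h : k ≤ n) (A : O n F) :
    IsDotSubspace k (colSpan A k) := by
  have hg : ∀ x y, (toLin' A.1 ∘ₗ pad F k n) x ⬝ᵥ (toLin' A.1 ∘ₗ pad F k n) y = x ⬝ᵥ y :=
    fun x y => by simp [O.mulVec_dotProduct, pad_dotProduct h]
  refine ⟨QuadraticMap.IsometryEquiv.symm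
    ⟨LinearEquiv.ofInjective _ (injective_of_isometry hg), fun x => ?_⟩⟩
  change (dotForm F n) ((toLin' A.1 ∘ₗ pad F k n) x) = _
  rw [dotForm_apply, dotForm_apply, hg]

/-- The `dot_k`-subspaces form a single orbit under the orthogonal group. -/
theorem exists_eq_colSpan (h2 : (2 : F) ≠ 0) {n k : ℕ} {W : Submodule F (Fin n → F)}
    (h : IsDotSubspace k W) : ∃ A : O n F, W = colSpan A k := by
  have hk := le_of_isDotSubspace h
  obtain ⟨e⟩ := h
  have hg : ∀ x y, (W.subtype ∘ₗ e.symm.toLinearEquiv.toLinearMap) x ⬝ᵥ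
      (W.subtype ∘ₗ e.symm.toLinearEquiv.toLinearMap) y = x ⬝ᵥ y := by
    refine dotProduct_of_self h2 fun x => ?_
    rw [← dotForm_apply, ← dotForm_apply]
    exact e.symm.map_app x
  obtain ⟨A, hA⟩ := exists_move_isometry h2 (pad_dotProduct hk) hg
  refine ⟨A, ?_⟩
  ext x
  rw [mem_colSpan]
  simp only [hA]
  constructor
  · intro hx
    exact ⟨e.toLinearEquiv ⟨x, hx⟩,
      congrArg Subtype.val (e.toLinearEquiv.symm_apply_apply ⟨x, hx⟩)⟩
  · rintro ⟨y, rfl⟩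
    exact (e.symm.toLinearEquiv y).2

/-! ### Stabilizers and orbit counting -/

theorem card_quotient_eq {G X : Type*} [Group G] (H : Subgroup G) {f : G → X}
    (hs : Function.Surjective f) (hf : ∀ a b, f a = f b ↔ a⁻¹ * b ∈ H) :
    Nat.card (G ⧸ H) = Nat.card X := by
  refine Nat.card_congr (Equiv.ofBijective
    (Quotient.lift f fun a b h => (hf a b).2 (QuotientGroup.leftRel_apply.1 h)) ⟨?_, ?_⟩)
  · rintro ⟨a⟩ ⟨b⟩ h
    exact QuotientGroup.eq.2 ((hf a b).1 h)
  · intro x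
    obtain ⟨a, rfl⟩ := hs x
    exact ⟨Quotient.mk _ a, rfl⟩

theorem blockHom_mulVec_pad {k n : ℕ} (h : k ≤ n) (A : O k F) (B : O (n - k) F)
    (x : Fin k → F) : (blockHom F h (A, B)).1 *ᵥ pad F k n x = pad F k n (A.1 *ᵥ x) := by
  ext i
  obtain ⟨i, rfl⟩ := (blockEquiv h).surjective i
  rw [mulVec, dotProduct, ← _root_.Equiv.sum_comp (blockEquiv h), Fintype.sum_sum_type]
  rcases i with i | i <;>
    simp [pad_blockEquiv_inl, pad_blockEquiv_inr, blockHom, mulVec, dotProduct]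

theorem colSpan_eq_of_le {n k : ℕ} (h : k ≤ n) {A B : O n F} (hle : colSpan A k ≤ colSpan B k) :
    colSpan A k = colSpan B k :=
  Submodule.eq_of_le_of_finrank_eq hle (by rw [finrank_colSpan h, finrank_colSpan h])

theorem colSpan_inv {n k : ℕ} {A : O n F} (h : colSpan A k = colSpan 1 k) :
    colSpan A⁻¹ k = colSpan 1 k := by
  simpa using (colSpan_eq_iff A 1).1 h

theorem apply_eq_zero_of_colSpan {n k : ℕ} {A : O n F} (h : colSpan A k = colSpan 1 k)
    {i j : Fin n} (hi : k ≤ i.1) (hj : j.1 < k) : A.1 i j = 0 := by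
  have h1 : Pi.single j (1 : F) ∈ colSpan (1 : O n F) k := by
    rw [colSpan_one, mem_range_pad]
    intro l hl
    exact Pi.single_eq_of_ne (by rintro rfl; omega) _
  rw [← mulVec_mem_colSpan A, mul_one, h, colSpan_one, mem_range_pad] at h1
  simpa using h1 i hi

theorem inv_apply {n : ℕ} (A : O n F) (i j : Fin n) : (A⁻¹).1 i j = A.1 j i := rfl

/-- The inverse is the transpose and stabilizes the same subspace, so the other off-diagonal block
vanishes too. -/
theorem apply_eq_zero_of_colSpan' {n k : ℕ} {A : O n F} (h : colSpan A k = colSpan 1 k)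
    {i j : Fin n} (hi : i.1 < k) (hj : k ≤ j.1) : A.1 i j = 0 := by
  rw [← inv_apply]
  exact apply_eq_zero_of_colSpan (colSpan_inv h) hj hi

/-- The block diagonal matrices are the stabilizer of the standard `dot_k`-subspace. -/
theorem mem_blockSubgroup {k n : ℕ} (h : k ≤ n) (M : O n F) :
    M ∈ blockSubgroup F h ↔ colSpan M k = colSpan 1 k := by
  constructor
  · rintro ⟨⟨A, B⟩, rfl⟩
    refine colSpan_eq_of_le h fun x hx => ?_
    obtain ⟨y, rfl⟩ := (mem_colSpan _ _).1 hx
    rw [blockHom_mulVec_pad, colSpan_one]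
    exact ⟨_, rfl⟩
  · intro hM
    set N := reindex (blockEquiv h).symm (blockEquiv h).symm M.1 with hN
    have h12 : N.toBlocks₁₂ = 0 := by
      ext i j
      exact apply_eq_zero_of_colSpan' hM (by simp [blockEquiv_inl]) (by simp [blockEquiv_inr])
    have h21 : N.toBlocks₂₁ = 0 := by
      ext i j
      exact apply_eq_zero_of_colSpan hM (by simp [blockEquiv_inr]) (by simp [blockEquiv_inl])
    have hNb : N = fromBlocks N.toBlocks₁₁ 0 0 N.toBlocks₂₂ := by
      rw [← h12, ← h21, fromBlocks_toBlocks]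
    have hMM := (mem_orthogonalGroup_iff (Fin n) F).1 M.2
    have hNN : N * Nᵀ = 1 := by
      rw [hN, transpose_reindex, reindex_apply, reindex_apply, submatrix_mul_equiv, hMM,
        submatrix_one_equiv]
    rw [hNb, fromBlocks_transpose, fromBlocks_multiply, ← fromBlocks_one] at hNN
    obtain ⟨e1, -, -, e2⟩ := fromBlocks_inj.1 hNN
    simp only [transpose_zero, Matrix.zero_mul, add_zero, zero_add] at e1 e2
    refine ⟨(⟨_, (mem_orthogonalGroup_iff _ F).2 e1⟩, ⟨_, (mem_orthogonalGroup_iff _ F).2 e2⟩),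
      Subtype.ext ?_⟩
    change reindex (blockEquiv h) (blockEquiv h) (fromBlocks N.toBlocks₁₁ 0 0 N.toBlocks₂₂) = M.1
    rw [← hNb, hN]
    ext i j
    simp

theorem dotBinomial_eq_card_quotient (h2 : (2 : F) ≠ 0) {k n : ℕ} (h : k ≤ n) :
    dotBinomial F n k = Nat.card (O n F ⧸ blockSubgroup F h) := by
  rw [card_quotient_eq (X := dotSubspaces F k n) _
    (f := fun A => ⟨colSpan A k, isDotSubspace_colSpan h A⟩)]
  · rfl
  · rintro ⟨W, hW⟩
    obtain ⟨A, hA⟩ := exists_eq_colSpan h2 hW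
    exact ⟨A, Subtype.ext hA.symm⟩
  · intro A B
    rw [mem_blockSubgroup, ← colSpan_eq_iff]
    exact Subtype.ext_iff

theorem card_blockSubgroup {k n : ℕ} (h : k ≤ n) :
    Nat.card (blockSubgroup F h) = Nat.card (O k F) * Nat.card (O (n - k) F) := by
  rw [← Nat.card_prod]
  exact (Nat.card_congr (MonoidHom.ofInjective (blockHom_injective F h)).toEquiv).symm

theorem dotBinomial_mul_card (h2 : (2 : F) ≠ 0) {k n : ℕ} (h : k ≤ n) :
    dotBinomial F n k * (Nat.card (O k F) * Nat.card (O (n - k) F)) = Nat.card (O n F) := by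
  rw [dotBinomial_eq_card_quotient h2 h, ← card_blockSubgroup h]
  exact (Subgroup.card_eq_card_quotient_mul_card_subgroup _).symm

/-- The stabilizer of the first basis vector. -/
def pointSubgroup (F : Type*) [Field F] (n : ℕ) : Subgroup (O (n + 1) F) :=
  ((blockHom F (Nat.le_add_left 1 n)).comp (MonoidHom.inr (O 1 F) (O n F))).range

/-- Fixing the first basis vector preserves its line, so the matrix is block diagonal; its 1 × 1
block must then be 1. -/
theorem mem_pointSubgroup {n : ℕ} (M : O (n + 1) F) :
    M ∈ pointSubgroup F n ↔ M.1 *ᵥ pad F 1 (n + 1) 1 = pad F 1 (n + 1) 1 := by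
  have hn := Nat.le_add_left 1 n
  constructor
  · rintro ⟨B, rfl⟩
    refine (blockHom_mulVec_pad hn 1 B 1).trans ?_
    simp
  · intro hM
    have hs : colSpan M 1 = colSpan 1 1 := by
      refine colSpan_eq_of_le hn fun x hx => ?_
      obtain ⟨y, rfl⟩ := (mem_colSpan _ _).1 hx
      have hy : y = y 0 • (1 : Fin 1 → F) := by
        ext i; rw [Subsingleton.elim i 0]; simp
      rw [hy, map_smul, mulVec_smul, hM, colSpan_one, ← map_smul]
      exact ⟨_, rfl⟩
    obtain ⟨⟨a, B⟩, rfl⟩ := (mem_blockSubgroup hn M).2 hs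
    rw [blockHom_mulVec_pad hn] at hM
    have ha := injective_of_isometry (pad_dotProduct hn) hM
    have ha1 : a = 1 := by
      ext i j
      have := congrFun ha 0
      rw [Subsingleton.elim i 0, Subsingleton.elim j 0]
      simpa [mulVec, dotProduct] using this
    exact ⟨B, by rw [ha1]; rfl⟩

theorem card_pointSubgroup (n : ℕ) : Nat.card (pointSubgroup F n) = Nat.card (O n F) := by
  refine (Nat.card_congr (MonoidHom.ofInjective ?_).toEquiv).symm
  intro A B h
  exact (Prod.ext_iff.1 (blockHom_injective F _ h)).2

theorem card_succ_eq_sphereCard_mul [Fintype F] (h2 : (2 : F) ≠ 0) (n : ℕ) :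
    Nat.card (O (n + 1) F) = sphereCard F (n + 1) 1 * Nat.card (O n F) := by
  have hn := Nat.le_add_left 1 n
  have he : pad F 1 (n + 1) 1 ⬝ᵥ pad F 1 (n + 1) 1 = (1 : F) := by
    rw [pad_dotProduct hn]; simp
  rw [Subgroup.card_eq_card_quotient_mul_card_subgroup (pointSubgroup F n), card_pointSubgroup,
    card_quotient_eq (X := {x : Fin (n + 1) → F // x ⬝ᵥ x = 1}) _
      (f := fun A => ⟨A.1 *ᵥ pad F 1 (n + 1) 1, by rw [O.mulVec_dotProduct, he]⟩)]
  · rfl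
  · rintro ⟨x, hx⟩
    obtain ⟨A, hA, -⟩ := exists_move h2 he hx
    exact ⟨A, Subtype.ext hA⟩
  · intro A B
    rw [Subtype.mk.injEq, mem_pointSubgroup, O.mul_mulVec]
    constructor
    · intro h
      rw [← h, O.inv_mulVec_mulVec]
    · intro h
      rw [← O.mulVec_inv_mulVec A (B.1 *ᵥ _), h]

theorem card_O_zero : Nat.card (O 0 F) = 1 := by
  have : Subsingleton (O 0 F) := ⟨fun A B => Subtype.ext (Subsingleton.elim _ _)⟩
  exact Nat.card_unique

/-! ### Orders of the orthogonal groups -/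

section Orders

variable [Fintype F]

/-- Pulling q² out of each factor links the products for n and n + 1. -/
theorem prod_sub_pow_shift (q : ℤ) (n : ℕ) :
    ∏ k ∈ Finset.range n, (q ^ (2 * (n + 1)) - q ^ (2 * (k + 1))) =
      (q ^ 2) ^ n * ∏ k ∈ Finset.range n, (q ^ (2 * n) - q ^ (2 * k)) := by
  have h := Finset.pow_card_mul_prod (s := Finset.range n) (b := q ^ 2)
    (f := fun k => q ^ (2 * n) - q ^ (2 * k))
  rw [Finset.card_range] at h
  rw [h]
  exact Finset.prod_congr rfl fun k _ => by ring

theorem prod_Icc_one_eq_range {M : Type*} [CommMonoid M] (f : ℕ → M) (n : ℕ) :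
    ∏ k ∈ Finset.Icc 1 n, f k = ∏ k ∈ Finset.range n, f (k + 1) := by
  induction n with
  | zero => simp
  | succ n ih => rw [Finset.prod_Icc_succ_top (by omega), ih, Finset.prod_range_succ]

theorem card_O_one (hF : ringChar F ≠ 2) : Nat.card (O 1 F) = 2 := by
  classical
  have h := sphereCard_odd F hF 0
  rw [card_succ_eq_sphereCard_mul (Ring.two_ne_zero hF) 0, card_O_zero]
  rw [mul_one]
  exact_mod_cast (by simpa using h : (sphereCard F 1 (1 : F) : ℤ) = 2)

theorem card_O_eq_factorial (hF : ringChar F ≠ 2) (n : ℕ) : Nat.card (O n F) = 2 ^ n * dotFactorial F n := by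
  induction n with
  | zero => simp [dotFactorial]
  | succ n ih =>
    have h := dotBinomial_mul_card (Ring.two_ne_zero hF) (Nat.le_add_left 1 n)
    rw [card_O_one hF, Nat.add_sub_cancel, ih] at h
    rw [← h, dotFactorial, dotFactorial, Finset.prod_Icc_succ_top (by omega), dotBracket,
      if_neg (Nat.succ_ne_zero n), dotBinomial]
    ring

theorem card_O_odd [DecidableEq F] (hF : ringChar F ≠ 2) (n : ℕ) :
    (Nat.card (O (2 * n + 1) F) : ℤ) =
    2 * (Fintype.card F : ℤ) ^ n * ∏ k ∈ Finset.range n,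
      ((Fintype.card F : ℤ) ^ (2 * n) - (Fintype.card F : ℤ) ^ (2 * k)) := by
  have h2 : (2 : F) ≠ 0 := Ring.two_ne_zero hF
  induction n with
  | zero => simp [card_O_one hF]
  | succ n ih =>
    -- With ε = χ(-1)^(n+1), the two new sphere sizes contribute (q^(n+1) - ε)(q^(n+1) + ε) =
    -- q^(2n+2) - 1, the k = 0 factor.
    have hη : (quadraticChar F (-1)) ^ (n + 1) * (quadraticChar F (-1)) ^ (n + 1) = 1 := by
      rw [← mul_pow, ← sq, quadraticChar_sq_one (neg_ne_zero.2 one_ne_zero), one_pow]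
    rw [card_succ_eq_sphereCard_mul h2, show 2 * (n + 1) = 2 * n + 1 + 1 by ring,
      card_succ_eq_sphereCard_mul h2, Nat.cast_mul, Nat.cast_mul, ih,
      show 2 * n + 1 + 1 + 1 = 2 * (n + 1) + 1 by ring, sphereCard_odd F hF,
      show 2 * n + 1 + 1 = 2 * n + 2 by ring, sphereCard_even F hF, Finset.prod_range_succ',
      show 2 * n + 2 = 2 * (n + 1) by ring, prod_sub_pow_shift]
    linear_combination (-2 * (Fintype.card F : ℤ) ^ (n + 1) * (Fintype.card F : ℤ) ^ n *
      (Fintype.card F : ℤ) ^ n * ∏ k ∈ Finset.range n,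
        ((Fintype.card F : ℤ) ^ (2 * n) - (Fintype.card F : ℤ) ^ (2 * k))) * hη

theorem card_O_even [DecidableEq F] (hF : ringChar F ≠ 2) (n : ℕ) :
    (Nat.card (O (2 * (n + 1)) F) : ℤ) =
    2 * ((Fintype.card F : ℤ) ^ (n + 1) - quadraticChar F (-1) ^ (n + 1)) *
      ∏ k ∈ Finset.Icc 1 n,
      ((Fintype.card F : ℤ) ^ (2 * (n + 1)) - (Fintype.card F : ℤ) ^ (2 * k)) := by
  rw [show 2 * (n + 1) = 2 * n + 1 + 1 by ring,
    card_succ_eq_sphereCard_mul (Ring.two_ne_zero hF), Nat.cast_mul, card_O_odd hF,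
    show 2 * n + 1 + 1 = 2 * n + 2 by ring, sphereCard_even F hF,
    show 2 * n + 2 = 2 * (n + 1) by ring, prod_Icc_one_eq_range, prod_sub_pow_shift]
  ring

end Orders

/-! ### Euclidean flags -/

theorem eq_colSpan_of_comparable {n k : ℕ} {W : Submodule F (Fin n → F)} {A : O n F}
    (hk : IsDotSubspace k W) (h : W ≤ colSpan A k ∨ colSpan A k ≤ W) : W = colSpan A k := by
  have hf : Module.finrank F W = Module.finrank F (colSpan A k) := by
    rw [finrank_of_isDotSubspace hk, finrank_colSpan (le_of_isDotSubspace hk)]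
  rcases h with h | h
  · exact Submodule.eq_of_le_of_finrank_eq h hf
  · exact (Submodule.eq_of_le_of_finrank_eq h hf.symm).symm

/-- The element of the Euclidean poset spanned by the first `k` columns of `A`. -/
def colPoint {n k : ℕ} (h : k ≤ n) (A : O n F) : EuclideanPoset F n :=
  ⟨colSpan A k, k, isDotSubspace_colSpan h A⟩

/-- The Euclidean flag spanned by the columns of an orthogonal matrix. -/
def colFlag {n : ℕ} (A : O n F) : EuclideanFlag F n where
  carrier := {W | ∃ k, k ≤ n ∧ W.1 = colSpan A k}
  Chain' := by
    rintro ⟨W, hW⟩ ⟨j, hj, rfl : W = _⟩ ⟨V, hV⟩ ⟨k, hk, rfl : V = _⟩ -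
    exact (le_total j k).imp (fun h => colSpan_mono h A) fun h => colSpan_mono h A
  max_chain' := by
    refine fun s hs hsub => hsub.antisymm fun W hW => ?_
    obtain ⟨k, hk⟩ := W.2
    have hkn := le_of_isDotSubspace hk
    refine ⟨k, hkn, eq_colSpan_of_comparable hk ?_⟩
    exact hs.total hW (hsub (a := colPoint hkn A) ⟨k, hkn, rfl⟩)

theorem mem_colFlag {n : ℕ} {A : O n F} {W : EuclideanPoset F n} :
    W ∈ colFlag A ↔ ∃ k, k ≤ n ∧ W.1 = colSpan A k := Iff.rfl

theorem colFlag_eq_iff {n : ℕ} (A B : O n F) :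
    colFlag A = colFlag B ↔ ∀ k ≤ n, colSpan A k = colSpan B k := by
  constructor
  · intro h k hk
    have hm : colPoint hk A ∈ colFlag B := h ▸ mem_colFlag.2 ⟨k, hk, rfl⟩
    obtain ⟨j, hj, e⟩ := mem_colFlag.1 hm
    have e' : colSpan A k = colSpan B j := e
    have := congrArg (fun W : Submodule F (Fin n → F) => Module.finrank F W) e'
    simp only [finrank_colSpan hk, finrank_colSpan hj] at this
    rw [e', this]
  · intro h
    refine SetLike.ext fun W => ?_
    rw [mem_colFlag, mem_colFlag]
    exact exists_congr fun k => and_congr_right fun hk => by rw [h k hk]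

/-- A `dot_m`-subspace containing the span of the first `k` columns of `A` is the span of the
first `m` columns of a matrix with the same partial flag up to `k`. -/
theorem exists_refine (h2 : (2 : F) ≠ 0) {n k m : ℕ} (hkm : k ≤ m) (hm : m ≤ n) {A B : O n F}
    (h : colSpan A k ≤ colSpan B m) :
    ∃ C : O n F, colSpan C m = colSpan B m ∧ ∀ j ≤ k, colSpan C j = colSpan A j := by
  have hex : ∀ x : Fin k → F, ∃ y, pad F m n y = (B⁻¹).1 *ᵥ (A.1 *ᵥ pad F k n x) := fun x =>
    (mem_colSpan_iff _ _).1 (h ((mem_colSpan _ _).2 ⟨x, rfl⟩))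
  -- g expresses the first k columns of A in the orthonormal basis formed by the first m columns of
  -- B. Extending g to P in O(m), the matrix B diag(P, 1) is the required one.
  let g : (Fin k → F) →ₗ[F] (Fin m → F) := pad F n m ∘ₗ toLin' (B⁻¹).1 ∘ₗ toLin' A.1 ∘ₗ pad F k n
  have hpg : ∀ x, B.1 *ᵥ pad F m n (g x) = A.1 *ᵥ pad F k n x := by
    intro x
    obtain ⟨y, hy⟩ := hex x
    have hgy : g x = y := by
      simp only [g, LinearMap.comp_apply, toLin'_apply, ← hy]
      ext i
      simp [pad_apply, i.2, i.2.trans_le hm]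
    rw [hgy, hy, O.mulVec_inv_mulVec]
  have hg : ∀ x y, g x ⬝ᵥ g y = x ⬝ᵥ y := by
    intro x y
    rw [← pad_dotProduct hm, ← O.mulVec_dotProduct B, hpg, hpg, O.mulVec_dotProduct,
      pad_dotProduct (hkm.trans hm)]
  obtain ⟨P, hP⟩ := exists_move_isometry h2 (pad_dotProduct hkm) hg
  refine ⟨B * blockHom F hm (P, 1), ?_, fun j hj => ?_⟩
  · have := (mem_blockSubgroup hm _).1 ⟨(P, 1), rfl⟩
    rw [eq_comm, colSpan_eq_iff, inv_mul_cancel_left, this]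
  · ext x
    rw [mem_colSpan, mem_colSpan]
    refine exists_congr fun y => ?_
    rw [O.mul_mulVec, ← pad_pad (hj.trans hkm), blockHom_mulVec_pad, ← pad_pad hj, hP, hpg,
      pad_pad hkm, pad_pad hj]

/-- The matrix is adapted to the chain one column at a time. A minimal member W of C above the k-th
span might jump to dimension m > k + 1, but `exists_refine` puts a (k+1)-dimensional span between
the two. That span is comparable with all of C, hence lies in C by maximality. -/
theorem exists_colPoint_mem (h2 : (2 : F) ≠ 0) [Finite F] {n : ℕ} (C : EuclideanFlag F n)
    (k : ℕ) (hk : k ≤ n) :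
    ∃ A : O n F, ∀ j (hj : j ≤ k), colPoint (hj.trans hk) A ∈ C := by
  induction k with
  | zero =>
    refine ⟨1, fun j hj => Flag.mem_iff_forall_le_or_ge.2 fun W _ => Or.inl ?_⟩
    obtain rfl := Nat.le_zero.1 hj
    rintro x hx
    obtain ⟨y, rfl⟩ := (mem_colSpan _ _).1 hx
    rw [Subsingleton.elim y 0, map_zero, mulVec_zero]
    exact W.1.zero_mem
  | succ k ih =>
    have hkn : k ≤ n := by omega
    obtain ⟨A, hA⟩ := ih hkn
    let s : Set (EuclideanPoset F n) := {W | W ∈ C ∧ colPoint hkn A < W}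
    have htop : ∀ W : EuclideanPoset F n, W ≤ colPoint le_rfl 1 := fun W x _ => by
      change x ∈ colSpan 1 n
      rw [colSpan_one]
      exact ⟨x, pad_self x⟩
    have hs : s.Nonempty := by
      refine ⟨colPoint le_rfl 1, Flag.mem_iff_forall_le_or_ge.2 fun W _ => Or.inr (htop W),
        lt_of_le_of_ne (htop _) fun e => ?_⟩
      have e' : colSpan A k = colSpan 1 n := congrArg Subtype.val e
      have := finrank_colSpan hkn A
      rw [e', finrank_colSpan le_rfl] at this
      omega
    obtain ⟨W, ⟨hWC, hAW⟩, hmin⟩ := s.toFinite.exists_minimal hs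
    obtain ⟨m, hm⟩ := W.2
    have hmn := le_of_isDotSubspace hm
    have hkm : k < m := by
      have := Submodule.finrank_lt_finrank_of_lt (show colSpan A k < W.1 from hAW)
      rwa [finrank_colSpan hkn, finrank_of_isDotSubspace hm] at this
    obtain ⟨B, hB⟩ := exists_eq_colSpan h2 hm
    obtain ⟨A', hA'm, hA'⟩ := exists_refine h2 hkm.le hmn (hB ▸ hAW.le : colSpan A k ≤ colSpan B m)
    refine ⟨A', fun j hj => ?_⟩
    rcases Nat.le_succ_iff.1 hj with hj' | rfl
    · have e : colPoint (hj.trans hk) A' = colPoint (hj'.trans hkn) A := Subtype.ext (hA' j hj')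
      rw [e]
      exact hA j hj'
    · refine Flag.mem_iff_forall_le_or_ge.2 fun X hX => ?_
      -- Members strictly above the k-th span contain W by minimality; all others lie below that
      -- span.
      by_cases hAX : colPoint hkn A < X
      · left
        have hWX : W ≤ X := (C.le_or_le hWC hX).elim id fun h => hmin ⟨hX, hAX⟩ h
        refine le_trans (?_ : colSpan A' (k + 1) ≤ W.1) hWX
        rw [hB, ← hA'm]
        exact colSpan_mono hkm A'
      · right
        have hXA : X ≤ colPoint hkn A := by
          rcases C.le_or_le hX (hA k le_rfl) with h | h
          · exact h
          · exact (eq_of_le_of_not_lt h hAX).ge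
        refine le_trans hXA (?_ : colSpan A k ≤ colSpan A' (k + 1))
        rw [← hA' k le_rfl]
        exact colSpan_mono (Nat.le_succ k) A'

theorem colFlag_surjective (h2 : (2 : F) ≠ 0) [Finite F] (n : ℕ) :
    Function.Surjective (colFlag : O n F → EuclideanFlag F n) := by
  intro C
  obtain ⟨A, hA⟩ := exists_colPoint_mem h2 C n le_rfl
  refine ⟨A, Flag.ext ((colFlag A).max_chain' C.chain_le ?_)⟩
  rintro W ⟨k, hk, hW⟩
  have e : W = colPoint hk A := Subtype.ext hW
  rw [e]
  exact hA k hk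

/-- The diagonal matrices with entries `±1`. -/
def signHom (F : Type*) [Field F] (n : ℕ) : (Fin n → ℤˣ) →* O n F where
  toFun ε := ⟨diagonal fun i => ((ε i : ℤ) : F), by
    rw [mem_orthogonalGroup_iff, diagonal_transpose, diagonal_mul_diagonal, ← diagonal_one]
    congr 1
    ext i
    rw [← Int.cast_mul, ← Units.val_mul, Int.units_mul_self]
    simp⟩
  map_one' := Subtype.ext (by simp)
  map_mul' ε δ := Subtype.ext (by simp [diagonal_mul_diagonal])

theorem signHom_injective (h2 : (2 : F) ≠ 0) (n : ℕ) : Function.Injective (signHom F n) := by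
  intro ε δ h
  ext i
  have h1 : ((ε i : ℤ) : F) = ((δ i : ℤ) : F) :=
    congrFun (diagonal_injective (congrArg Subtype.val h)) i
  have hne : (1 : F) ≠ -1 := fun e => h2 (by linear_combination e)
  rcases Int.units_eq_one_or (ε i) with e | e <;> rcases Int.units_eq_one_or (δ i) with d | d <;>
    rw [e, d] at h1 ⊢ <;> simp [hne, hne.symm] at h1

/-- Preserving every standard span kills the entries on both sides of the diagonal, and
orthogonality makes each diagonal entry square to 1. -/
theorem mem_range_signHom {n : ℕ} (M : O n F) :
    M ∈ (signHom F n).range ↔ ∀ k ≤ n, colSpan M k = colSpan 1 k := by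
  constructor
  · rintro ⟨ε, rfl⟩ k hk
    refine colSpan_eq_of_le hk fun x hx => ?_
    obtain ⟨y, rfl⟩ := (mem_colSpan _ _).1 hx
    rw [colSpan_one, mem_range_pad]
    intro i hi
    simp [signHom, mulVec_diagonal, pad_apply, hi]
  · intro h
    have hoff : ∀ i j, i ≠ j → M.1 i j = 0 := by
      intro i j hij
      rcases lt_or_gt_of_ne hij with hlt | hlt
      · exact apply_eq_zero_of_colSpan' (h j (by omega)) hlt le_rfl
      · exact apply_eq_zero_of_colSpan (h i (by omega)) le_rfl hlt
    have hdiag : M.1 = diagonal fun i => M.1 i i := by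
      ext i j
      by_cases hij : i = j
      · simp [hij]
      · rw [hoff i j hij, diagonal_apply_ne _ hij]
    have hsq : ∀ i, M.1 i i = 1 ∨ M.1 i i = -1 := by
      intro i
      have := (mem_orthogonalGroup_iff (Fin n) F).1 M.2
      rw [hdiag, diagonal_transpose, diagonal_mul_diagonal, ← diagonal_one] at this
      exact mul_self_eq_one_iff.1 (congrFun (diagonal_injective this) i)
    have hε : ∀ i, ∃ u : ℤˣ, ((u : ℤ) : F) = M.1 i i := by
      intro i
      rcases hsq i with e | e
      · exact ⟨1, by simp [e]⟩
      · exact ⟨-1, by simp [e]⟩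
    choose ε hε using hε
    refine ⟨ε, Subtype.ext ?_⟩
    change diagonal _ = M.1
    rw [hdiag]
    simp only [hε]

theorem card_flag_mul (h2 : (2 : F) ≠ 0) [Finite F] (n : ℕ) :
    Nat.card (EuclideanFlag F n) * 2 ^ n = Nat.card (O n F) := by
  have hc : Nat.card (signHom F n).range = 2 ^ n := by
    rw [← Nat.card_congr (MonoidHom.ofInjective (signHom_injective h2 n)).toEquiv]
    simp
  rw [Subgroup.card_eq_card_quotient_mul_card_subgroup (signHom F n).range, hc,
    card_quotient_eq _ (colFlag_surjective h2 n)]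
  intro A B
  rw [colFlag_eq_iff, mem_range_signHom]
  exact forall₂_congr fun k _ => colSpan_eq_iff A B

end DotAnalogue

theorem mainTheorem10 (F : Type*) [Field F] [Fintype F] (hF : ringChar F ≠ 2) :
    -- Euclidean flags, factorials and the order of the orthogonal group
    (∀ n : ℕ,
      Nat.card (DotAnalogue.EuclideanFlag F n) = DotAnalogue.dotFactorial F n ∧
      (Nat.card (DotAnalogue.EuclideanFlag F n) : ℚ)
        = (Nat.card (DotAnalogue.O n F) : ℚ) / 2 ^ n ∧
      Nat.card (DotAnalogue.O n F) = 2 ^ n * DotAnalogue.dotFactorial F n) ∧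
    -- the explicit order in odd dimension `2 n + 1`
    (∀ n : ℕ,
      (Nat.card (DotAnalogue.O (2 * n + 1) F) : ℤ)
        = 2 * (Fintype.card F : ℤ) ^ n *
          ∏ k ∈ Finset.range n,
            ((Fintype.card F : ℤ) ^ (2 * n) - (Fintype.card F : ℤ) ^ (2 * k))) ∧
    -- the explicit order in even dimension `2 n`
    (∀ n : ℕ, 1 ≤ n →
      (Fintype.card F ≡ 1 [MOD 4] →
        (Nat.card (DotAnalogue.O (2 * n) F) : ℤ)
          = 2 * ((Fintype.card F : ℤ) ^ n - 1) *
            ∏ k ∈ Finset.Icc 1 (n - 1),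
              ((Fintype.card F : ℤ) ^ (2 * n) - (Fintype.card F : ℤ) ^ (2 * k))) ∧
      (Fintype.card F ≡ 3 [MOD 4] →
        (Nat.card (DotAnalogue.O (2 * n) F) : ℤ)
          = 2 * ((Fintype.card F : ℤ) ^ n + (-1) ^ (n + 1)) *
            ∏ k ∈ Finset.Icc 1 (n - 1),
              ((Fintype.card F : ℤ) ^ (2 * n) - (Fintype.card F : ℤ) ^ (2 * k)))) ∧
    -- dot-binomial coefficients
    (∀ (n k : ℕ) (h : k ≤ n),
      (DotAnalogue.dotBinomial F n k : ℚ)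
        = (DotAnalogue.dotFactorial F n : ℚ) /
          ((DotAnalogue.dotFactorial F k : ℚ) * (DotAnalogue.dotFactorial F (n - k) : ℚ)) ∧
      DotAnalogue.dotBinomial F n k
        = Nat.card (DotAnalogue.O n F ⧸ DotAnalogue.blockSubgroup F h)) := by
  classical
  have h2 : (2 : F) ≠ 0 := Ring.two_ne_zero hF
  have hO := DotAnalogue.card_O_eq_factorial hF
  have hpos : ∀ n, (DotAnalogue.dotFactorial F n : ℚ) ≠ 0 := by
    intro n h
    have h0 : Nat.card (DotAnalogue.O n F) = 0 := by
      rw [hO, Nat.cast_eq_zero.1 h, mul_zero]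
    exact Nat.card_pos.ne' h0
  refine ⟨fun n => ?_, DotAnalogue.card_O_odd hF, fun n hn => ?_, fun n k h => ⟨?_, ?_⟩⟩
  · have hfl := DotAnalogue.card_flag_mul h2 n
    refine ⟨?_, ?_, hO n⟩
    · refine Nat.eq_of_mul_eq_mul_right (pow_pos two_pos n) ?_
      rw [hfl, hO, mul_comm]
    · rw [← hfl, Nat.cast_mul, Nat.cast_pow, Nat.cast_ofNat,
        mul_div_cancel_right₀ _ (pow_ne_zero n two_ne_zero)]
  · obtain ⟨n, rfl⟩ := Nat.exists_eq_add_of_le' hn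
    -- χ(-1) = χ₄(q) is 1 or -1 according to q mod 4.
    rw [DotAnalogue.card_O_even hF, quadraticChar_neg_one hF, Nat.add_sub_cancel]
    refine ⟨fun h1 => ?_, fun h3 => ?_⟩
    · rw [ZMod.χ₄_nat_one_mod_four h1, one_pow]
    · rw [ZMod.χ₄_nat_three_mod_four h3]
      ring
  · have hb := DotAnalogue.dotBinomial_mul_card h2 h
    rw [hO, hO, hO, ← Nat.sub_add_cancel h, Nat.add_sub_cancel, pow_add] at hb
    rw [eq_div_iff (mul_ne_zero (hpos k) (hpos (n - k)))]
    rw [Nat.sub_add_cancel h] at hb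
    refine mul_left_cancel₀ (pow_ne_zero n (two_ne_zero' ℚ)) ?_
    have hb' := congrArg (Nat.cast : ℕ → ℚ) hb
    rw [← pow_add, Nat.sub_add_cancel h] at hb'
    have h2n : (2 : ℚ) ^ n = 2 ^ k * 2 ^ (n - k) := by rw [← pow_add, Nat.add_sub_cancel' h]
    push_cast at hb'
    rw [← hb', h2n]
    ring
  · exact DotAnalogue.dotBinomial_eq_card_quotient h2 h
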